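/- For $\mathbb{R}^n$-valued signals let $\ell_{2e}^{0+}$ be the space of all sequences $u=(u_k)_{k\ge 0}$ in $\mathbb{R}^n$, let $P_\tau u$ be the truncation with $(P_\tau u)_k=u_k$ for $0\le k\le\tau$ and $(P_\tau u)_k=0$ for $k>\tau$, and let $\|\cdot\|$ be the $\ell_2$ norm. The extended graph of a system $\Gamma:\ell_{2e}^{0+}\to\ell_{2e}^{0+}$ is $\mathscr{G}_e(\Gamma)=\{(x,\Gamma x): x\in\ell_{2e}^{0+}\}$, whose elements are regarded as stacked signals with $\|P_\tau(x,y)\|^2=\|P_\tau x\|^2+\|P_\tau y\|^2$. The directed gap between two systems with the same input and output dimensions is $$\vec\delta(\Gamma_1,\Gamma_2)=\limsup_{\tau\to\infty}\ \sup_{\substack{v\in\mathscr{G}_e(\Gamma_2)\\ \|P_\tau v\|\neq 0}}\ \inf_{\substack{u\in\mathscr{G}_e(\Gamma_1)\\ \|P_\tau u\|\neq 0}}\frac{\|P_\tau(u-v)\|}{\|P_\tau u\|}\in[0,\infty]$$ (with $\sup\emptyset=0$ and $\inf\emptyset=\infty$). **Lemma.** Let $G$ be a $p\times m$ matrix of proper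 real-rational transfer functions, with expansion $G(z)=\sum_{k\ge0}G_kz^{-k}$ at infinity, and identify $G$ with the causal linear time-invariant system $(Gu)_k=\sum_{j=0}^{k}G_{k-j}u_j$ (it need not be stable). Let $0<\underline\lambda<1<\bar\lambda$ and, for $\lambda\in[\underline\lambda,\bar\lambda]$, let $G_\lambda=\lambda_-G\lambda_+$, where $(\lambda_+y)_k=\lambda^ky_k$ and $(\lambda_-y)_k=\lambda^{-k}y_k$. Then $\lambda\mapsto G_\lambda$ is continuous in the directed gap on $[\underline\lambda,\bar\lambda]$: for every $\varepsilon>0$ there is $\delta>0$ such that $\vec\delta(G_\nu,G_\mu)<\varepsilon$ for all $\nu,\mu\in[\underline\lambda,\bar\lambda]$ with $|\nu-\mu|<\delta$. -/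

import Mathlib

open scoped ENNReal

noncomputable section

/-- The one-sided extended signal space with values in `V`. A two-sided signal that vanishes at all
negative times is the same thing as a function on `ℕ`, and every truncation of it is square
summable, so no further condition is needed. -/
abbrev ExtSignal (V : Type*) : Type _ := ℕ → V

/-- The truncation operator `P_τ`. -/
def truncation {V : Type*} [Zero V] (τ : ℕ) (u : ExtSignal V) : ExtSignal V :=
  fun k => if k ≤ τ then u k else 0

/-- The `ℓ₂` norm of a signal (only ever applied to square summable signals below). -/
def l2Norm {V : Type*} [Norm V] (u : ExtSignal V) : ℝ :=
  Real.sqrt (∑' k, ‖u k‖ ^ 2)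

/-- The norm `‖P_τ u‖` is a finite sum. -/
theorem l2Norm_truncation {V : Type*} [NormedAddCommGroup V] (τ : ℕ) (u : ExtSignal V) :
    l2Norm (truncation τ u) = Real.sqrt (∑ k ∈ Finset.range (τ + 1), ‖u k‖ ^ 2) := by
  unfold l2Norm
  congr 1
  rw [tsum_eq_sum (s := Finset.range (τ + 1))]
  · refine Finset.sum_congr rfl fun k hk => ?_
    have : k ≤ τ := Nat.lt_succ_iff.mp (Finset.mem_range.mp hk)
    simp [truncation, this]
  · intro k hk
    have : ¬ k ≤ τ := fun h => hk (Finset.mem_range.mpr (Nat.lt_succ_of_le h))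
    simp [truncation, this]

/-- The extended graph of a system `Γ`: all stacked signals `[x; Γ x]`. The values are stacked with
the Euclidean norm `‖(a, b)‖² = ‖a‖² + ‖b‖²`. -/
def extGraph {V W : Type*} (Γ : ExtSignal V → ExtSignal W) : Set (ExtSignal (WithLp 2 (V × W))) :=
  {w | ∃ x : ExtSignal V, w = fun k => WithLp.toLp 2 (x k, Γ x k)}

/-- The directed gap `limsup_{τ → ∞} sup_v inf_u ‖P_τ (u - v)‖ / ‖P_τ u‖`, where `v` runs through
the extended graph of `Γ₂`, `u` through the extended graph of `Γ₁`, and both `P_τ v` and `P_τ u`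
are non-zero. It takes values in `[0, ∞]`. -/
def directedGap {V W : Type*} [NormedAddCommGroup V] [NormedAddCommGroup W]
    (Γ₁ Γ₂ : ExtSignal V → ExtSignal W) : ℝ≥0∞ :=
  Filter.limsup
    (fun τ : ℕ =>
      ⨆ v ∈ {v | v ∈ extGraph Γ₂ ∧ l2Norm (truncation τ v) ≠ 0},
        ⨅ u ∈ {u | u ∈ extGraph Γ₁ ∧ l2Norm (truncation τ u) ≠ 0},
          ENNReal.ofReal (l2Norm (truncation τ (u - v)) / l2Norm (truncation τ u)))
    Filter.atTop

/-- Continuity of a family of systems in the directed gap on the parameter set `S`. -/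
def GapContinuousOn {V W : Type*} [NormedAddCommGroup V] [NormedAddCommGroup W]
    (S : Set ℝ) (Γ : ℝ → ExtSignal V → ExtSignal W) : Prop :=
  ∀ ε : ℝ, 0 < ε → ∃ δ : ℝ, 0 < δ ∧ ∀ ν ∈ S, ∀ μ ∈ S, |ν - μ| < δ →
    directedGap (Γ ν) (Γ μ) < ENNReal.ofReal ε

/-- The scaling `(r₊ y)_k = r ^ k y_k`. -/
def scalePlus {V : Type*} [SMul ℝ V] (r : ℝ) (y : ExtSignal V) : ExtSignal V :=
  fun k => r ^ k • y k

/-- The scaling `(r₋ y)_k = r ^ (-k) y_k`. -/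
def scaleMinus {V : Type*} [SMul ℝ V] (r : ℝ) (y : ExtSignal V) : ExtSignal V :=
  fun k => r ^ (-(k : ℤ)) • y k

/-- The exponentially weighted system `Γ_r = r₋ Γ r₊`. -/
def expWeighted {V W : Type*} [SMul ℝ V] [SMul ℝ W] (r : ℝ)
    (Γ : ExtSignal V → ExtSignal W) : ExtSignal V → ExtSignal W :=
  fun u => scaleMinus r (Γ (scalePlus r u))

/-- The `p × m` matrices of proper real-rational transfer functions: in every entry the degree of
the numerator is at most the degree of the denominator. -/
def properRational (p m : ℕ) : Set (Matrix (Fin p) (Fin m) (RatFunc ℝ)) :=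
  {G | ∀ i j, (G i j).num.natDegree ≤ (G i j).denom.natDegree}

/-- The impulse response of a proper rational function `g = a / b`, i.e. the coefficients of its
expansion `g(z) = ∑ₖ gₖ z⁻ᵏ` at infinity. With `d = deg b` and `q = z⁻¹`, the expansion is the
quotient of the polynomials `q ^ d a(1 / q)` and `q ^ d b(1 / q)` in the power series ring; the
second one has a non-zero constant term. -/
def impulseResponse (g : RatFunc ℝ) (k : ℕ) : ℝ :=
  PowerSeries.coeff k
    (((Polynomial.reflect g.denom.natDegree g.num : Polynomial ℝ) : PowerSeries ℝ) *
      ((Polynomial.reflect g.denom.natDegree g.denom : Polynomial ℝ) : PowerSeries ℝ)⁻¹)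

/-- The causal LTI system on extended signals with the proper transfer matrix `G`: convolution with
the impulse response, `y_k = ∑_{j ≤ k} G_{k - j} u_j`. -/
def ltiSystem {p m : ℕ} (G : Matrix (Fin p) (Fin m) (RatFunc ℝ)) :
    ExtSignal (EuclideanSpace ℝ (Fin m)) → ExtSignal (EuclideanSpace ℝ (Fin p)) :=
  fun u k => WithLp.toLp 2 fun i =>
    ∑ j ∈ Finset.range (k + 1), ∑ l, impulseResponse (G i l) (k - j) * u j l

end

/-! Write `q = z⁻¹` and clear denominators: `G = A / b` with `A`, `b` polynomial in `q`, so the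
graph of `G` on power series is the kernel of `C = [-A, b I]`. Over the PID `ℝ[q]` this kernel is a
direct summand, so a polynomial matrix `E` projects onto it. In the time domain `E` is a filter of
finite impulse response that maps every signal into the graph and fixes the graph. It is bounded on
truncations uniformly in `τ`, even when `G` is unstable.

Weighting by `r` replaces the coefficients `E_i` by `r⁻ⁱ E_i`: finitely many, and uniformly
continuous in `r` on a compact interval away from `0`. For `v` in the graph of `G_μ`, the signal `u
= E_ν v` lies in the graph of `G_ν`, and `u - v = (E_ν - E_μ) v` is small relative to `v`, hence to
`u`. The work is in `exists_polynomial_projection_onto_graph` and `gapContinuousOn_expWeighted`. -/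

open scoped Matrix

/-! ### Polynomial projections onto graphs -/

/-- Over a principal ideal domain the kernel of a matrix is a direct summand, hence the range of a
matrix that restricts to the identity on it. -/
theorem Matrix.exists_projection_onto_ker {R : Type*} [CommRing R] [IsDomain R]
    [IsPrincipalIdealRing R] {a n : Type*} [Fintype a] [Fintype n] [DecidableEq n]
    (C : Matrix a n R) :
    ∃ E : Matrix n n R, C * E = 0 ∧ ∀ {k : Type} (B : Matrix n k R), C * B = 0 → E * B = B := by
  -- The range of `C` is a submodule of a finite free module over a PID, hence projective, so `C`
  -- has a section `s` over its range; the projection is `1 - s C`.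
  obtain ⟨s, hs⟩ := Module.projective_lifting_property C.mulVecLin.rangeRestrict LinearMap.id
    C.mulVecLin.surjective_rangeRestrict
  have hs' (x : n → R) : C *ᵥ s (C.mulVecLin.rangeRestrict x) = C *ᵥ x :=
    congrArg Subtype.val (LinearMap.congr_fun hs (C.mulVecLin.rangeRestrict x))
  have hE (x : n → R) : LinearMap.toMatrix' (LinearMap.id - s ∘ₗ C.mulVecLin.rangeRestrict) *ᵥ x =
      x - s (C.mulVecLin.rangeRestrict x) := by
    rw [LinearMap.toMatrix'_mulVec]; rfl
  refine ⟨LinearMap.toMatrix' (LinearMap.id - s ∘ₗ C.mulVecLin.rangeRestrict), ?_, ?_⟩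
  · apply Matrix.ext_of_mulVec_single
    intro i
    rw [← Matrix.mulVec_mulVec, hE, Matrix.mulVec_sub, hs', sub_self, Matrix.zero_mulVec]
  · intro k B hB
    ext i j
    have h0 : C *ᵥ (fun i => B i j) = 0 := by
      ext i; exact congrFun (congrFun hB i) j
    have h1 : C.mulVecLin.rangeRestrict (fun i => B i j) = 0 := Subtype.ext h0
    have := congrFun (hE (fun i => B i j)) i
    rw [h1, map_zero, sub_zero] at this
    exact this

open Polynomial in
/-- The graph of a matrix of power series with a common polynomial denominator `b` is the range of
a polynomial matrix that restricts to the identity on it. -/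
theorem exists_polynomial_projection_onto_graph {p m : ℕ} (b : ℝ[X]) (hb : b ≠ 0)
    (A : Matrix (Fin p) (Fin m) ℝ[X]) (g : Matrix (Fin p) (Fin m) (PowerSeries ℝ))
    (hg : ∀ i l, (b : PowerSeries ℝ) * g i l = (A i l : PowerSeries ℝ)) :
    ∃ E : Matrix (Fin m ⊕ Fin p) (Fin m ⊕ Fin p) ℝ[X],
      (∀ P : Fin m ⊕ Fin p → PowerSeries ℝ, (∀ i, P (.inr i) = ∑ l, g i l * P (.inl l)) →
        E.map (fun f => (f : PowerSeries ℝ)) *ᵥ P = P) ∧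
      ∀ P : Fin m ⊕ Fin p → PowerSeries ℝ, ∀ i,
        (E.map (fun f => (f : PowerSeries ℝ)) *ᵥ P) (.inr i) =
          ∑ l, g i l * (E.map (fun f => (f : PowerSeries ℝ)) *ᵥ P) (.inl l) := by
  have hb' : (b : PowerSeries ℝ) ≠ 0 := by simpa using hb
  let φ : ℝ[X] →+* PowerSeries ℝ := coeToPowerSeries.ringHom
  obtain ⟨E, hCE, hE⟩ := Matrix.exists_projection_onto_ker
    (Matrix.fromCols (-A) (b • (1 : Matrix (Fin p) (Fin p) ℝ[X])))
  -- The columns of `[b I; A]` lie in the kernel because `-A b + b A = 0`.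
  have hEB := hE (Matrix.fromRows (b • (1 : Matrix (Fin m) (Fin m) ℝ[X])) A)
    (by rw [Matrix.fromCols_mul_fromRows]; simp)
  have hφ : E.map (fun f => (f : PowerSeries ℝ)) = E.map φ := rfl
  refine ⟨E, fun P hP => ?_, fun P i => ?_⟩
  -- A graph vector becomes a combination of the columns of `[b I; A]` only after multiplication by
  -- `b`. So `E` fixes `b P`, and `b` is then cancelled.
  · have hB : φ b • P = (Matrix.fromRows (b • (1 : Matrix (Fin m) (Fin m) ℝ[X])) A).map φ *ᵥ
        (fun l => P (.inl l)) := by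
      ext1 s
      rcases s with l | i
      · simp [Matrix.mulVec, dotProduct, Matrix.one_apply, apply_ite φ]
      · have : φ b * P (.inr i) = ∑ l, φ (A i l) * P (.inl l) := by
          rw [hP, Finset.mul_sum]
          exact Finset.sum_congr rfl fun l _ => by rw [← mul_assoc]; congr 1; exact hg i l
        simpa [Matrix.mulVec, dotProduct] using this
    have h1 : φ b • (E.map φ *ᵥ P) = φ b • P := by
      rw [← Matrix.mulVec_smul, hB, Matrix.mulVec_mulVec, ← Matrix.map_mul, hEB]
    rw [hφ]
    ext1 s
    exact mul_left_cancel₀ hb' (congrFun h1 s)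
  · rw [hφ]
    set Q := E.map φ *ᵥ P with hQ
    have h0 : (Matrix.fromCols (-A) (b • (1 : Matrix (Fin p) (Fin p) ℝ[X]))).map φ *ᵥ Q = 0 := by
      rw [hQ, Matrix.mulVec_mulVec, ← Matrix.map_mul, hCE]; simp
    have h1 := congrFun h0 i
    simp only [Matrix.mulVec, dotProduct, Fintype.sum_sum_type, Matrix.map_apply,
      Matrix.fromCols_apply_inl, Matrix.fromCols_apply_inr, Matrix.neg_apply, Matrix.smul_apply,
      Matrix.one_apply, smul_eq_mul, mul_ite, mul_one, mul_zero, apply_ite φ, map_zero, ite_mul,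
      zero_mul, Finset.sum_ite_eq, Finset.mem_univ, if_true, map_neg, neg_mul,
      Finset.sum_neg_distrib, Pi.zero_apply] at h1
    apply mul_left_cancel₀ hb'
    rw [Finset.mul_sum]
    have : φ b * Q (.inr i) = ∑ l, φ (A i l) * Q (.inl l) := by linear_combination h1
    refine this.trans (Finset.sum_congr rfl fun l _ => ?_)
    rw [← mul_assoc]; congr 1; exact (hg i l).symm

open Polynomial in
/-- Finitely many fractions have a common denominator. -/
theorem exists_common_denominator {p m : ℕ} (a d : Matrix (Fin p) (Fin m) ℝ[X])
    (hd : ∀ i l, (d i l).coeff 0 ≠ 0) :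
    ∃ (b : ℝ[X]) (A : Matrix (Fin p) (Fin m) ℝ[X]), b ≠ 0 ∧ ∀ i l,
      (b : PowerSeries ℝ) * ((a i l : PowerSeries ℝ) * (d i l : PowerSeries ℝ)⁻¹) =
        (A i l : PowerSeries ℝ) := by
  have hdvd (i l) : d i l ∣ ∏ s : Fin p × Fin m, d s.1 s.2 :=
    Finset.dvd_prod_of_mem (fun s : Fin p × Fin m => d s.1 s.2) (Finset.mem_univ (i, l))
  choose c hc using hdvd
  refine ⟨∏ s : Fin p × Fin m, d s.1 s.2, fun i l => a i l * c i l, ?_, fun i l => ?_⟩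
  · exact Finset.prod_ne_zero_iff.2 fun s _ h => hd s.1 s.2 (by simp [h])
  · rw [hc i l, coe_mul, coe_mul]
    have : (d i l : PowerSeries ℝ) * (d i l : PowerSeries ℝ)⁻¹ = 1 :=
      PowerSeries.mul_inv_cancel _ (by simpa using hd i l)
    linear_combination (a i l * c i l : PowerSeries ℝ) * this

/-! ### Truncated norms and finite impulse response filters -/

/-- The truncated norm is the norm of a finite tuple. -/
theorem l2Norm_truncation_eq_norm {V : Type*} [NormedAddCommGroup V] (τ : ℕ) (u : ExtSignal V) :
    l2Norm (truncation τ u) =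
      ‖(WithLp.toLp 2 fun k : Fin (τ + 1) => u k : PiLp 2 fun _ : Fin (τ + 1) => V)‖ := by
  rw [l2Norm_truncation, PiLp.norm_eq_of_L2, Finset.sum_range]

theorem l2Norm_truncation_add_le {V : Type*} [NormedAddCommGroup V] (τ : ℕ) (u v : ExtSignal V) :
    l2Norm (truncation τ (u + v)) ≤ l2Norm (truncation τ u) + l2Norm (truncation τ v) := by
  simp only [l2Norm_truncation_eq_norm]
  exact norm_add_le (WithLp.toLp 2 fun k : Fin (τ + 1) => u k : PiLp 2 fun _ : Fin (τ + 1) => V)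
    (WithLp.toLp 2 fun k : Fin (τ + 1) => v k)

theorem l2Norm_truncation_sum_le {V ι : Type*} [NormedAddCommGroup V] (τ : ℕ) (s : Finset ι)
    (u : ι → ExtSignal V) :
    l2Norm (truncation τ (∑ i ∈ s, u i)) ≤ ∑ i ∈ s, l2Norm (truncation τ (u i)) := by
  refine Finset.le_sum_of_subadditive (fun u : ExtSignal V => l2Norm (truncation τ u)) ?_
    (l2Norm_truncation_add_le τ) s u
  simp [l2Norm_truncation]

/-- The truncated norm of a delayed signal, filtered by a bounded operator. -/
theorem l2Norm_truncation_delay_le {V : Type*} [NormedAddCommGroup V] [NormedSpace ℝ V] (τ i : ℕ)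
    (L : V →L[ℝ] V) (u : ExtSignal V) :
    l2Norm (truncation τ fun k => if i ≤ k then L (u (k - i)) else 0) ≤
      ‖L‖ * l2Norm (truncation τ u) := by
  rw [l2Norm_truncation, l2Norm_truncation]
  refine Real.sqrt_le_iff.2 ⟨by positivity, ?_⟩
  rw [mul_pow, Real.sq_sqrt (Finset.sum_nonneg fun _ _ => by positivity), Finset.mul_sum]
  calc ∑ k ∈ Finset.range (τ + 1), ‖if i ≤ k then L (u (k - i)) else 0‖ ^ 2
      = ∑ k ∈ (Finset.range (τ + 1)).filter (i ≤ ·), ‖L (u (k - i))‖ ^ 2 := by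
        rw [Finset.sum_filter]
        exact Finset.sum_congr rfl fun k _ => by split_ifs <;> simp
    _ ≤ ∑ k ∈ (Finset.range (τ + 1)).filter (i ≤ ·), ‖L‖ ^ 2 * ‖u (k - i)‖ ^ 2 := by
        refine Finset.sum_le_sum fun k _ => ?_
        rw [← mul_pow]
        exact pow_le_pow_left₀ (norm_nonneg _) (L.le_opNorm _) 2
    -- The shift `k ↦ k - i` is injective only on `i ≤ k`, which is why the sum was restricted
    -- first.
    _ = ∑ j ∈ ((Finset.range (τ + 1)).filter (i ≤ ·)).image (· - i), ‖L‖ ^ 2 * ‖u j‖ ^ 2 := by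
        rw [Finset.sum_image]
        intro x hx y hy hxy
        have := (Finset.mem_filter.1 hx).2
        have := (Finset.mem_filter.1 hy).2
        simp only at hxy
        omega
    _ ≤ ∑ j ∈ Finset.range (τ + 1), ‖L‖ ^ 2 * ‖u j‖ ^ 2 := by
        refine Finset.sum_le_sum_of_subset_of_nonneg ?_ fun _ _ _ => by positivity
        intro j hj
        obtain ⟨k, hk, rfl⟩ := Finset.mem_image.1 hj
        have := Finset.mem_range.1 (Finset.mem_filter.1 hk).1
        exact Finset.mem_range.2 (by omega)

/-- Convolution with a finite impulse response supported on `i < D`. -/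
noncomputable def firFilter {V : Type*} [NormedAddCommGroup V] [NormedSpace ℝ V] (D : ℕ) (E : ℕ → V →L[ℝ] V)
    (u : ExtSignal V) : ExtSignal V :=
  ∑ i ∈ Finset.range D, fun k => if i ≤ k then E i (u (k - i)) else 0

theorem firFilter_apply {V : Type*} [NormedAddCommGroup V] [NormedSpace ℝ V] (D : ℕ)
    (E : ℕ → V →L[ℝ] V) (u : ExtSignal V) (k : ℕ) :
    firFilter D E u k = ∑ i ∈ Finset.range D, if i ≤ k then E i (u (k - i)) else 0 := by
  simp [firFilter]

/-- The constant is independent of `τ`, since causal delays never see past the truncation time. -/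
theorem l2Norm_truncation_firFilter_le {V : Type*} [NormedAddCommGroup V] [NormedSpace ℝ V]
    (τ D : ℕ) (E : ℕ → V →L[ℝ] V) (u : ExtSignal V) :
    l2Norm (truncation τ (firFilter D E u)) ≤
      (∑ i ∈ Finset.range D, ‖E i‖) * l2Norm (truncation τ u) := by
  rw [Finset.sum_mul]
  exact (l2Norm_truncation_sum_le τ _ _).trans
    (Finset.sum_le_sum fun i _ => l2Norm_truncation_delay_le τ i (E i) u)

/-! ### Exponential weighting and the gap estimate -/

theorem scalePlus_scaleMinus {V : Type*} [NormedAddCommGroup V] [NormedSpace ℝ V] {r : ℝ}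
    (hr : r ≠ 0) (u : ExtSignal V) : scalePlus r (scaleMinus r u) = u := by
  funext k
  simp [scalePlus, scaleMinus, smul_smul, hr]

theorem scaleMinus_scalePlus {V : Type*} [NormedAddCommGroup V] [NormedSpace ℝ V] {r : ℝ}
    (hr : r ≠ 0) (u : ExtSignal V) : scaleMinus r (scalePlus r u) = u := by
  funext k
  simp [scalePlus, scaleMinus, smul_smul, hr]

/-- The tap with delay `i` picks up `r⁻ᵏ rᵏ⁻ⁱ = r⁻ⁱ`, which does not depend on the time `k`. -/
theorem scaleMinus_firFilter_scalePlus {V : Type*} [NormedAddCommGroup V] [NormedSpace ℝ V] {r : ℝ}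
    (hr : r ≠ 0) (D : ℕ) (E : ℕ → V →L[ℝ] V) (u : ExtSignal V) :
    scaleMinus r (firFilter D E (scalePlus r u)) = firFilter D (fun i => (r ^ i)⁻¹ • E i) u := by
  funext k
  simp only [scaleMinus, firFilter_apply, Finset.smul_sum, smul_ite, smul_zero]
  refine Finset.sum_congr rfl fun i _ => ?_
  split_ifs with h
  · simp only [scalePlus, map_smul, smul_smul, smul_apply]
    congr 1
    obtain ⟨j, rfl⟩ := Nat.exists_eq_add_of_le h
    rw [zpow_neg, zpow_natCast, Nat.add_sub_cancel_left, pow_add]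
    field_simp
  · rfl

theorem scaleMinus_mem_extGraph_expWeighted {V W : Type*} [NormedAddCommGroup V] [NormedSpace ℝ V]
    [NormedAddCommGroup W] [NormedSpace ℝ W] (Γ : ExtSignal V → ExtSignal W) {r : ℝ} (hr : r ≠ 0)
    {w : ExtSignal (WithLp 2 (V × W))} (hw : w ∈ extGraph Γ) :
    scaleMinus r w ∈ extGraph (expWeighted r Γ) := by
  obtain ⟨x, rfl⟩ := hw
  refine ⟨scaleMinus r x, ?_⟩
  funext k
  rw [expWeighted, scalePlus_scaleMinus hr]
  rfl

theorem scalePlus_mem_extGraph {V W : Type*} [NormedAddCommGroup V] [NormedSpace ℝ V]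
    [NormedAddCommGroup W] [NormedSpace ℝ W] (Γ : ExtSignal V → ExtSignal W) {r : ℝ} (hr : r ≠ 0)
    {v : ExtSignal (WithLp 2 (V × W))} (hv : v ∈ extGraph (expWeighted r Γ)) :
    scalePlus r v ∈ extGraph Γ := by
  obtain ⟨x, rfl⟩ := hv
  refine ⟨scalePlus r x, ?_⟩
  have := scalePlus_scaleMinus hr (Γ (scalePlus r x))
  funext k
  rw [← this]
  rfl

/-- If some filter of finite impulse response is a projection onto the graph of `Γ`, then the
exponentially weighted systems depend continuously on the weight. -/
theorem gapContinuousOn_expWeighted {V W : Type*} [NormedAddCommGroup V] [NormedSpace ℝ V]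
    [NormedAddCommGroup W] [NormedSpace ℝ W] (Γ : ExtSignal V → ExtSignal W) (D : ℕ)
    (E : ℕ → WithLp 2 (V × W) →L[ℝ] WithLp 2 (V × W))
    (hfix : ∀ v ∈ extGraph Γ, firFilter D E v = v) (hmem : ∀ w, firFilter D E w ∈ extGraph Γ)
    {lo hi : ℝ} (hlo : 0 < lo) :
    GapContinuousOn (Set.Icc lo hi) (fun r => expWeighted r Γ) := by
  intro ε hε
  -- The bound `1 / 2` yields `‖P_τ v‖ ≤ 2 ‖P_τ u‖`; the bound `ε / 4` then makes the ratio at most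
  -- `2 η ≤ ε / 2`.
  set η : ℝ := min (1 / 2) (ε / 4) with hη
  have hη0 : 0 < η := lt_min (by norm_num) (by linarith)
  have hη2 : η ≤ 1 / 2 := min_le_left _ _
  have hηε : η ≤ ε / 4 := min_le_right _ _
  obtain ⟨δ, hδ, hδη⟩ : ∃ δ > 0, ∀ ν ∈ Set.Icc lo hi, ∀ μ ∈ Set.Icc lo hi, |ν - μ| < δ →
      ∑ i ∈ Finset.range D, ‖(ν ^ i)⁻¹ • E i - (μ ^ i)⁻¹ • E i‖ < η := by
    let F : ℝ → Fin D → (WithLp 2 (V × W) →L[ℝ] WithLp 2 (V × W)) := fun r i => (r ^ (i : ℕ))⁻¹ • E i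
    have hF : ContinuousOn F (Set.Icc lo hi) := by
      refine continuousOn_pi.2 fun i => ContinuousOn.smul
        (ContinuousOn.inv₀ (continuous_pow (i : ℕ)).continuousOn ?_)
        continuousOn_const
      exact fun r hr => pow_ne_zero _ (hlo.trans_le hr.1).ne'
    have hu := isCompact_Icc.uniformContinuousOn_of_continuous hF
    obtain ⟨δ, hδ, h⟩ := Metric.uniformContinuousOn_iff.1 hu (η / (D + 1)) (by positivity)
    refine ⟨δ, hδ, fun ν hν μ hμ hd => ?_⟩
    have h1 := h ν hν μ hμ (by rwa [Real.dist_eq])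
    calc ∑ i ∈ Finset.range D, ‖(ν ^ i)⁻¹ • E i - (μ ^ i)⁻¹ • E i‖
        = ∑ i : Fin D, dist (F ν i) (F μ i) := by
          rw [Finset.sum_range]; simp only [F, dist_eq_norm]
      _ ≤ ∑ _i : Fin D, η / (D + 1) :=
          Finset.sum_le_sum fun i _ => ((dist_le_pi_dist _ _ i).trans_lt h1).le
      _ = η * (D / (D + 1)) := by simp; ring
      _ < η * 1 := by
          refine mul_lt_mul_of_pos_left ?_ hη0
          rw [div_lt_one (by positivity)]; linarith
      _ = η := mul_one _
  refine ⟨δ, hδ, fun ν hν μ hμ hd => ?_⟩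
  have hν0 : ν ≠ 0 := (hlo.trans_le hν.1).ne'
  have hμ0 : μ ≠ 0 := (hlo.trans_le hμ.1).ne'
  -- A limsup inherits only a weak bound, so `ε / 2` leaves room for the strict inequality.
  refine lt_of_le_of_lt (b := ENNReal.ofReal (ε / 2)) ?_
    ((ENNReal.ofReal_lt_ofReal_iff hε).2 (by linarith))
  refine Filter.limsup_le_of_le (by isBoundedDefault) (Filter.Eventually.of_forall fun τ => ?_)
  refine iSup₂_le fun v hv => ?_
  -- The competitor is the weighted projection of `v` onto the graph at `ν`.
  set u := scaleMinus ν (firFilter D E (scalePlus ν v)) with hu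
  have hvfix : v = scaleMinus μ (firFilter D E (scalePlus μ v)) := by
    rw [hfix _ (scalePlus_mem_extGraph Γ hμ0 hv.1), scaleMinus_scalePlus hμ0]
  have huv : u - v = firFilter D (fun i => (ν ^ i)⁻¹ • E i - (μ ^ i)⁻¹ • E i) v := by
    rw [scaleMinus_firFilter_scalePlus hμ0] at hvfix
    rw [hu, scaleMinus_firFilter_scalePlus hν0]
    funext k
    rw [Pi.sub_apply, congrFun hvfix k]
    simp only [firFilter_apply, ← Finset.sum_sub_distrib]
    refine Finset.sum_congr rfl fun i _ => ?_
    split_ifs <;> simp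
  have hvpos : 0 < l2Norm (truncation τ v) := lt_of_le_of_ne (Real.sqrt_nonneg _) (Ne.symm hv.2)
  have hdiff : l2Norm (truncation τ (u - v)) ≤ η * l2Norm (truncation τ v) := by
    rw [huv]
    exact (l2Norm_truncation_firFilter_le _ _ _ _).trans
      (mul_le_mul_of_nonneg_right (hδη ν hν μ hμ hd).le hvpos.le)
  have hvle : l2Norm (truncation τ v) ≤
      l2Norm (truncation τ u) + l2Norm (truncation τ (u - v)) := by
    have h := l2Norm_truncation_add_le τ u (v - u)
    rw [add_sub_cancel] at h
    refine h.trans_eq (congrArg _ ?_)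
    simp only [l2Norm_truncation, Pi.sub_apply, norm_sub_rev]
  -- Besides bounding the ratio, this makes `P_τ u` nonzero, so that `u` is admissible in the
  -- infimum.
  have hhalf : l2Norm (truncation τ v) ≤ 2 * l2Norm (truncation τ u) := by nlinarith
  have hupos : 0 < l2Norm (truncation τ u) := by linarith
  refine iInf₂_le_of_le u
    ⟨scaleMinus_mem_extGraph_expWeighted Γ hν0 (hmem _), hupos.ne'⟩ (ENNReal.ofReal_le_ofReal ?_)
  rw [div_le_iff₀ hupos]
  nlinarith

/-! ### Stacked signals as power series -/

/-- The coordinates of a stacked vector. -/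
noncomputable def stackCoord (m p : ℕ) : WithLp 2 (EuclideanSpace ℝ (Fin m) × EuclideanSpace ℝ (Fin p)) ≃ₗ[ℝ]
    (Fin m ⊕ Fin p → ℝ) :=
  (WithLp.linearEquiv 2 ℝ (EuclideanSpace ℝ (Fin m) × EuclideanSpace ℝ (Fin p))).trans
    (((WithLp.linearEquiv 2 ℝ (Fin m → ℝ)).prodCongr (WithLp.linearEquiv 2 ℝ (Fin p → ℝ))).trans
      (LinearEquiv.sumArrowLequivProdArrow (Fin m) (Fin p) ℝ ℝ).symm)

/-- The generating power series of the coordinates of a stacked signal. -/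
noncomputable def signalSeries {m p : ℕ}
    (w : ExtSignal (WithLp 2 (EuclideanSpace ℝ (Fin m) × EuclideanSpace ℝ (Fin p)))) :
    Fin m ⊕ Fin p → PowerSeries ℝ :=
  fun s => PowerSeries.mk fun k => stackCoord m p (w k) s

theorem signalSeries_injective {m p : ℕ} : Function.Injective (signalSeries (m := m) (p := p)) := by
  intro v w h
  funext k
  apply (stackCoord m p).injective
  funext s
  simpa [signalSeries] using congrArg (PowerSeries.coeff k) (congrFun h s)

/-- A stacked signal lies in the graph of an LTI system iff its generating series do. -/
theorem mem_extGraph_ltiSystem_iff {p m : ℕ} (G : Matrix (Fin p) (Fin m) (RatFunc ℝ))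
    (w : ExtSignal (WithLp 2 (EuclideanSpace ℝ (Fin m) × EuclideanSpace ℝ (Fin p)))) :
    w ∈ extGraph (ltiSystem G) ↔ ∀ i, signalSeries w (.inr i) =
      ∑ l, PowerSeries.mk (impulseResponse (G i l)) * signalSeries w (.inl l) := by
  have key (i : Fin p) (k : ℕ) : PowerSeries.coeff k
      (∑ l, PowerSeries.mk (impulseResponse (G i l)) * signalSeries w (.inl l)) =
      ltiSystem G (fun k => (w k).fst) k i := by
    simp only [map_sum, mul_comm (PowerSeries.mk _), PowerSeries.coeff_mul,
      Finset.Nat.sum_antidiagonal_eq_sum_range_succ_mk]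
    rw [Finset.sum_comm]
    refine Finset.sum_congr rfl fun j _ => Finset.sum_congr rfl fun l _ => ?_
    rw [mul_comm, PowerSeries.coeff_mk, signalSeries, PowerSeries.coeff_mk]
    rfl
  have hout (i : Fin p) (k : ℕ) :
      PowerSeries.coeff k (signalSeries w (.inr i)) = (w k).snd i := by
    rw [signalSeries, PowerSeries.coeff_mk]; rfl
  constructor
  · rintro ⟨x, hx⟩ i
    ext k
    rw [key, hout, hx]
    rfl
  · intro h
    refine ⟨fun k => (w k).fst, funext fun k => ?_⟩
    have : (w k).snd = ltiSystem G (fun k => (w k).fst) k := by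
      ext i
      rw [← key, ← h, hout]
    rw [← this]
    rfl

/-- The continuous linear map with matrix `M` in the coordinates `e`. -/
noncomputable def matrixOperator {H n : Type*} [NormedAddCommGroup H] [NormedSpace ℝ H] [FiniteDimensional ℝ H]
    [Fintype n] (e : H ≃ₗ[ℝ] (n → ℝ)) (M : Matrix n n ℝ) : H →L[ℝ] H :=
  LinearMap.toContinuousLinearMap (e.symm.toLinearMap ∘ₗ M.mulVecLin ∘ₗ e.toLinearMap)

theorem matrixOperator_apply {H n : Type*} [NormedAddCommGroup H] [NormedSpace ℝ H]
    [FiniteDimensional ℝ H] [Fintype n] (e : H ≃ₗ[ℝ] (n → ℝ)) (M : Matrix n n ℝ) (x : H) :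
    e (matrixOperator e M x) = M *ᵥ e x := by
  simp [matrixOperator]

instance (m p : ℕ) : FiniteDimensional ℝ
    (WithLp 2 (EuclideanSpace ℝ (Fin m) × EuclideanSpace ℝ (Fin p))) :=
  (stackCoord m p).symm.finiteDimensional

open Polynomial in
/-- The action of the `i`-th coefficient of a polynomial matrix on stacked vectors. -/
noncomputable def coeffOperator {m p : ℕ} (E : Matrix (Fin m ⊕ Fin p) (Fin m ⊕ Fin p) ℝ[X]) (i : ℕ) :
    WithLp 2 (EuclideanSpace ℝ (Fin m) × EuclideanSpace ℝ (Fin p)) →L[ℝ]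
      WithLp 2 (EuclideanSpace ℝ (Fin m) × EuclideanSpace ℝ (Fin p)) :=
  matrixOperator (stackCoord m p) (E.map fun f => f.coeff i)

open Polynomial in
/-- On generating series, filtering is multiplication by the polynomial matrix. -/
theorem signalSeries_firFilter {m p : ℕ} (E : Matrix (Fin m ⊕ Fin p) (Fin m ⊕ Fin p) ℝ[X]) (D : ℕ)
    (hD : ∀ s t, (E s t).natDegree < D)
    (w : ExtSignal (WithLp 2 (EuclideanSpace ℝ (Fin m) × EuclideanSpace ℝ (Fin p)))) :
    signalSeries (firFilter D (coeffOperator E) w) =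
      E.map (fun f => (f : PowerSeries ℝ)) *ᵥ signalSeries w := by
  funext s
  ext k
  have h1 : PowerSeries.coeff k (signalSeries (firFilter D (coeffOperator E) w) s) =
      ∑ i ∈ Finset.range D, ∑ t, if i ≤ k then (E s t).coeff i * stackCoord m p (w (k - i)) t
        else 0 := by
    rw [signalSeries, PowerSeries.coeff_mk, firFilter_apply, map_sum, Finset.sum_apply]
    refine Finset.sum_congr rfl fun i _ => ?_
    split_ifs
    · rw [coeffOperator, matrixOperator_apply]; rfl
    · simp
  rw [h1, Finset.sum_comm]
  simp only [Matrix.mulVec, dotProduct, map_sum, Matrix.map_apply, PowerSeries.coeff_mul,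
    Polynomial.coeff_coe, Finset.Nat.sum_antidiagonal_eq_sum_range_succ_mk, signalSeries,
    PowerSeries.coeff_mk]
  refine Finset.sum_congr rfl fun t _ => ?_
  rw [← Finset.sum_filter]
  -- The Cauchy product also contains indices `i ≥ D`, where the coefficients of `E s t` vanish by
  -- degree.
  refine Finset.sum_subset_zero_on_sdiff (fun i hi => ?_) (fun i hi => ?_) fun _ _ => rfl
  · have := (Finset.mem_filter.1 hi).2
    exact Finset.mem_range.2 (by omega)
  · simp only [Finset.mem_sdiff, Finset.mem_range, Finset.mem_filter, not_and] at hi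
    rw [Polynomial.coeff_eq_zero_of_natDegree_lt ((hD s t).trans_le ?_), zero_mul]
    by_contra h
    exact hi.2 (by omega) (by omega)

theorem mk_impulseResponse (g : RatFunc ℝ) : PowerSeries.mk (impulseResponse g) =
    ((Polynomial.reflect g.denom.natDegree g.num : Polynomial ℝ) : PowerSeries ℝ) *
      ((Polynomial.reflect g.denom.natDegree g.denom : Polynomial ℝ) : PowerSeries ℝ)⁻¹ := by
  ext k
  rw [PowerSeries.coeff_mk]
  rfl

/-! ### Assembly for rational transfer matrices -/

theorem mainTheorem8 {p m : ℕ} (G : Matrix (Fin p) (Fin m) (RatFunc ℝ))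
    (hG : G ∈ properRational p m) (lo hi : ℝ) (hlo : 0 < lo) (hlo1 : lo < 1) (hhi : 1 < hi) :
    GapContinuousOn (Set.Icc lo hi) (fun r => expWeighted r (ltiSystem G)) := by
  obtain ⟨b, A, hb, hA⟩ := exists_common_denominator
    (fun i l => Polynomial.reflect (G i l).denom.natDegree (G i l).num)
    (fun i l => Polynomial.reflect (G i l).denom.natDegree (G i l).denom)
    -- The constant term of the reversed denominator is the leading coefficient of the denominator.
    (fun i l => by
      rw [Polynomial.coeff_reflect, Polynomial.revAt_le (Nat.zero_le _), Nat.sub_zero]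
      exact Polynomial.leadingCoeff_ne_zero.2 (RatFunc.denom_ne_zero _))
  obtain ⟨E, hfix, hmem⟩ := exists_polynomial_projection_onto_graph b hb A
    (fun i l => PowerSeries.mk (impulseResponse (G i l)))
    (fun i l => by rw [mk_impulseResponse]; exact hA i l)
  obtain ⟨D, hD⟩ : ∃ D, ∀ s t, (E s t).natDegree < D := by
    refine ⟨(∑ s, ∑ t, (E s t).natDegree) + 1, fun s t => Nat.lt_succ_of_le ?_⟩
    exact (Finset.single_le_sum (f := fun t => (E s t).natDegree) (fun _ _ => Nat.zero_le _)
      (Finset.mem_univ t)).trans (Finset.single_le_sum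
        (f := fun s => ∑ t, (E s t).natDegree) (fun _ _ => Nat.zero_le _) (Finset.mem_univ s))
  refine gapContinuousOn_expWeighted (ltiSystem G) D (coeffOperator E) (fun v hv => ?_)
    (fun w => ?_) hlo
  · apply signalSeries_injective
    rw [signalSeries_firFilter E D hD]
    exact hfix _ ((mem_extGraph_ltiSystem_iff G v).1 hv)
  · rw [mem_extGraph_ltiSystem_iff, signalSeries_firFilter E D hD]
    exact hmem _
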